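/- Let $T$ be a Borel automorphism of $\mathbb{R}^n$ (a bijection such that $T$ and $T^{-1}$ are Borel measurable), and let $\Sigma_j = I + \varepsilon_j u_j u_j'$ for $1 \le j \le n$, where $\varepsilon_j > -1$ and $\varepsilon_j \neq 0$ for every $j$, and $\{u_1,\dots,u_n\}$ is a basis of $\mathbb{R}^n$ consisting of unit vectors. Let $L$ be Lebesgue measure on $\mathbb{R}^n$ and let $D_n$ be the set of diagonal $n\times n$ matrices with diagonal entries $\pm 1$. A Lebesgue partition is a family $\{E_s\}_{s\in D_n}$ of Borel sets such that $\mathbb{R}^n\setminus\bigcup_s E_s$ and $E_s\cap E_t$ ($s\ne t$) all have Lebesgue measure zero. Write $N(m,S)$ for the Gaussian measure with mean $m$ and positive definite covariance matrix $S$; a measure is called Gaussian if it is of this form. Then $N(0,I)T^{-1}=N(0,I)$ and $N(0,\Sigma_j)T^{-1}$ is Gaussian for every $j$ if and only if there exist orthogonal $n\times n$ matrices $U,V$ and a Lebesgue partition $\{E_s\}_{s\in D_n}$ such that (i) $T(x)=\sum_{s\in D_n} 1_{E_s}(x)\, V s U x$ for Lebesgue almost every $x$; (ii) $\{V s U(E_s)\}_{s\in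 D_n}$ is also a Lebesgue partition; (iii) there is a basis $\{v_1,\dots,v_n\}$ of $\mathbb{R}^n$ consisting of unit vectors such that $V s U u_j \in\{v_j,-v_j\}$ for every $j$ and every $s\in D_n$ with $L(E_s)>0$. Moreover, in that case, for all orthogonal $U,V$ and every Lebesgue partition $\{E_s\}_{s\in D_n}$ satisfying (i) and (ii), there is a basis $\{v_j\}$ of unit vectors as in (iii) such that, in addition, (iv) $N(0,\Sigma_j)T^{-1}=N(0,I+\varepsilon_j v_j v_j')$ for every $j$. -/

import Mathlib

open MeasureTheory ProbabilityTheory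

/-- The rank one perturbation `I + ε u u'` of the identity matrix. -/
noncomputable def rankOnePerturbation {n : ℕ} (ε : ℝ) (u : EuclideanSpace ℝ (Fin n)) :
    Matrix (Fin n) (Fin n) ℝ :=
  1 + ε • Matrix.vecMulVec u.ofLp u.ofLp

/-- The diagonal matrix with the diagonal entries `s 0, …, s (n - 1) ∈ {1, -1}`. The map
`s ↦ signMatrix s` is a bijection from `Fin n → ℤˣ` onto the set `D_n` of all diagonal matrices
of order `n` with diagonal entries `±1`, so collections indexed by `D_n` are written as families
indexed by `Fin n → ℤˣ`. -/
def signMatrix {n : ℕ} (s : Fin n → ℤˣ) : Matrix (Fin n) (Fin n) ℝ :=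
  Matrix.diagonal fun i => ((s i : ℤ) : ℝ)

/-- The linear map `x ↦ V s U x` of `ℝⁿ`. -/
noncomputable def signMap {n : ℕ} (U V : Matrix (Fin n) (Fin n) ℝ) (s : Fin n → ℤˣ) :
    EuclideanSpace ℝ (Fin n) →ₗ[ℝ] EuclideanSpace ℝ (Fin n) :=
  Matrix.toEuclideanLin (V * signMatrix s * U)

/-- A Lebesgue partition of `ℝⁿ` over the diagonal sign matrices: Borel sets that cover `ℝⁿ` up
to a Lebesgue null set and whose pairwise intersections are Lebesgue null. -/
structure IsLebesguePartition {n : ℕ} (E : (Fin n → ℤˣ) → Set (EuclideanSpace ℝ (Fin n))) :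
    Prop where
  measurableSet : ∀ s, MeasurableSet (E s)
  cover : volume (Set.univ \ ⋃ s, E s) = 0
  inter : ∀ s t, s ≠ t → volume (E s ∩ E t) = 0

/-- `U`, `V` are orthogonal, `{E_s}` and `{V s U (E_s)}` are Lebesgue partitions, and
`T x = ∑_s 1_{E_s}(x) V s U x` for Lebesgue almost every `x`. -/
structure IsSignRepresentation {n : ℕ}
    (T : EuclideanSpace ℝ (Fin n) → EuclideanSpace ℝ (Fin n))
    (U V : Matrix (Fin n) (Fin n) ℝ)
    (E : (Fin n → ℤˣ) → Set (EuclideanSpace ℝ (Fin n))) : Prop where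
  orthogonal_left : U ∈ Matrix.orthogonalGroup (Fin n) ℝ
  orthogonal_right : V ∈ Matrix.orthogonalGroup (Fin n) ℝ
  partition : IsLebesguePartition E
  ae_eq : ∀ᵐ x, T x = ∑ s, (E s).indicator (fun y => signMap U V s y) x
  image_partition : IsLebesguePartition fun s => signMap U V s '' E s

/-- A (nonsingular) gaussian probability measure `N(m, S)` on `ℝⁿ`, with some mean vector `m` and
some positive definite covariance matrix `S`. -/
def IsNonsingularGaussian {n : ℕ} (μ : Measure (EuclideanSpace ℝ (Fin n))) : Prop :=
  ∃ (m : EuclideanSpace ℝ (Fin n)) (S : Matrix (Fin n) (Fin n) ℝ),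
    S.PosDef ∧ μ = multivariateGaussian m S

/-- `T` maps `N(0, I)` to itself and each `N(0, I + ε_j u_j u_j')` to a gaussian measure. -/
def PreservesNormality {n : ℕ} (T : EuclideanSpace ℝ (Fin n) → EuclideanSpace ℝ (Fin n))
    (ε : Fin n → ℝ) (u : Fin n → EuclideanSpace ℝ (Fin n)) : Prop :=
  (multivariateGaussian 0 (1 : Matrix (Fin n) (Fin n) ℝ)).map T = multivariateGaussian 0 1 ∧
    ∀ j, IsNonsingularGaussian ((multivariateGaussian 0 (rankOnePerturbation (ε j) (u j))).map T)

/-!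
The standard Gaussian measure `γ = N(0, I)` is preserved by `T`, so `T` carries densities with
respect to `γ` to densities of the image measures. The density of `N(0, I + ε u u')` is
`exp (c + a ⟪u, x⟫²)` with `a = ε / (2 (1 + ε)) ≠ 0` and `c` depending only on `ε`, and every
nonsingular Gaussian measure has density `exp q` with `q` quadratic. If the image of
`N(0, I + ε u u')` is Gaussian, then `(q - c) / a` is a quadratic function whose composition with
`T` is `⟪u, x⟫²` almost everywhere; it is nonnegative and has under `γ` the law of the square of a
standard normal variable. After diagonalization and completion of squares, the comparison of
Laplace transforms shows that such a function is `⟪v, y⟫²` for a unit vector `v`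
(`exists_eq_inner_sq_of_integral_exp`). Hence `⟪v j, T x⟫² = ⟪u j, x⟫²` almost everywhere, for
every `j` (`exists_inner_sq_eq_of_isNonsingularGaussian_map`). Conversely, these identities and the
invariance of `γ` give back the images of the measures `N(0, I + ε_j u_j u_j')`
(`map_multivariateGaussian_rankOnePerturbation`).

Let `A` and `B` be the matrices with rows `u j` and `v j`. Then `B (T x) = s(x) A x` for a diagonal
sign matrix `s(x)`, and `B` is invertible because `A` is (`linearIndependent_of_inner_sq_eq`). Where
`s(x) = s` on a set of positive measure, `T` agrees there with the linear map `B⁻¹ s A`. The change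
of variables formula and the fact that a quadratic form is constant on a set of positive measure
only if it is zero (`quadratic_eq_zero_of_volume_ne_zero`) make `B⁻¹ s A` orthogonal
(`norm_map_eq_of_map_stdGaussian_eq`). This means `B B' = s A A' s`, and as positive square roots
are unique, `B⁻¹ s A = V s U` with the orthogonal matrices `U = (A A')^(-1/2) A` and
`V = B⁻¹ (B B')^(1/2)`, the same for all such `s` (`exists_orthogonal_factors`).

For any sign representation, `γ` is preserved because each `V s U` is orthogonal and both families
of pieces are partitions (`IsSignRepresentation.map_stdGaussian`). On a piece of positive measure
the identity `⟪v j, T x⟫² = ⟪u j, x⟫²` amounts to `V s U u_j = ± v_j`.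
-/

open scoped RealInnerProductSpace ENNReal MatrixOrder

/-! ### Null sets of quadratic functions -/

section NullSets

variable {E : Type*} [NormedAddCommGroup E] [InnerProductSpace ℝ E] [FiniteDimensional ℝ E]
  [MeasurableSpace E] [BorelSpace E]

/-- A quadratic form that takes a constant value on a set of positive measure vanishes
identically. -/
theorem quadratic_eq_zero_of_volume_ne_zero (B : E →ₗ[ℝ] E →ₗ[ℝ] ℝ) (c : ℝ)
    (h : volume {x | B x x = c} ≠ 0) : c = 0 ∧ ∀ x, B x x = 0 := by
  have hne : {x | B x x = c}.Nonempty := nonempty_of_measure_ne_zero h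
  suffices hB : ∀ x, B x x = 0 by
    obtain ⟨x, hx⟩ := hne
    exact ⟨by rw [← hx.out, hB x], hB⟩
  by_contra! hB
  obtain ⟨e, he⟩ := hB
  have hcont : Continuous fun x => B x x := by
    have h2 : (fun x => B x x) = fun x =>
      (LinearMap.toContinuousLinearMap (LinearMap.toContinuousLinearMap.toLinearMap ∘ₗ B)) x x := by
      ext x; simp
    rw [h2]; fun_prop
  have hmeas : MeasurableSet {x | B x x = c}ᶜ :=
    ((isClosed_singleton (x := c)).preimage hcont).measurableSet.compl
  refine h ?_
  have key := ae_mem_of_ae_add_linearMap_mem (LinearMap.toSpanSingleton ℝ E e)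
    (volume : Measure ℝ) (volume : Measure E) hmeas ?_
  · simpa [ae_iff] using key
  intro y
  -- along the line through `y` in the direction `e` the form is a polynomial of degree two
  let p : Polynomial ℝ := Polynomial.C (B e e) * Polynomial.X ^ 2 +
    Polynomial.C (B e y + B y e) * Polynomial.X + Polynomial.C (B y y - c)
  have hp : p ≠ 0 := fun h0 => he <| by
    have := congrArg (fun q => Polynomial.coeff q 2) h0
    simpa [p, Polynomial.coeff_X, Polynomial.coeff_C] using this
  have hfin : {t : ℝ | p.IsRoot t}.Finite := Polynomial.finite_setOfPred_isRoot hp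
  filter_upwards [hfin.countable.ae_notMem volume] with t ht hc
  apply ht
  simp only [Set.mem_ofPred_eq, LinearMap.toSpanSingleton_apply, map_add, map_smul,
    LinearMap.add_apply, LinearMap.smul_apply, smul_eq_mul] at hc
  simp only [Polynomial.IsRoot, p, Polynomial.eval_add, Polynomial.eval_mul,
    Polynomial.eval_C, Polynomial.eval_pow, Polynomial.eval_X]
  linarith

theorem eq_zero_of_volume_inner_eq_zero {w : E} (h : volume {x | ⟪w, x⟫ = 0} ≠ 0) : w = 0 := by
  by_contra hw
  refine h ?_
  have : {x : E | ⟪w, x⟫ = 0} = ((innerₛₗ ℝ w).ker : Set E) := by ext; simp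
  rw [this]
  refine Measure.addHaar_submodule _ _ fun htop => hw ?_
  have : w ∈ (innerₛₗ ℝ w).ker := htop ▸ Submodule.mem_top
  simpa using this

theorem eq_or_eq_neg_of_volume_inner_sq_eq {a b : E}
    (h : volume {x | ⟪a, x⟫ ^ 2 = ⟪b, x⟫ ^ 2} ≠ 0) : a = b ∨ a = -b := by
  have hsub : {x | ⟪a, x⟫ ^ 2 = ⟪b, x⟫ ^ 2} ⊆
      {x | ⟪a - b, x⟫ = 0} ∪ {x | ⟪a + b, x⟫ = 0} := by
    intro x hx
    have : ⟪a - b, x⟫ * ⟪a + b, x⟫ = 0 := by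
      rw [inner_sub_left, inner_add_left]; linarith [hx.out]
    exact mul_eq_zero.1 this
  by_cases h1 : volume {x | ⟪a - b, x⟫ = 0} = 0
  · by_cases h2 : volume {x | ⟪a + b, x⟫ = 0} = 0
    · exact absurd (measure_mono_null hsub (measure_union_null h1 h2)) h
    · exact Or.inr (eq_neg_of_add_eq_zero_left (eq_zero_of_volume_inner_eq_zero h2))
  · exact Or.inl (sub_eq_zero.1 (eq_zero_of_volume_inner_eq_zero h1))

theorem norm_map_eq_of_volume_ne_zero (W : E →ₗ[ℝ] E) (c : ℝ)
    (h : volume {x | ‖W x‖ ^ 2 - ‖x‖ ^ 2 = c} ≠ 0) : ∀ x, ‖W x‖ = ‖x‖ := by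
  have := (quadratic_eq_zero_of_volume_ne_zero
    ((innerₗ E).compl₁₂ W W - innerₗ E) c (by simpa using h)).2
  intro x
  have hx := this x
  simp only [LinearMap.sub_apply, LinearMap.compl₁₂_apply, innerₗ_apply_apply,
    real_inner_self_eq_norm_sq] at hx
  exact (sq_eq_sq₀ (norm_nonneg _) (norm_nonneg _)).1 (by linarith)

end NullSets

/-! ### The standard Gaussian measure -/

section StandardGaussian

variable {E : Type*} [NormedAddCommGroup E] [InnerProductSpace ℝ E]

variable (E) in
/-- The density of the standard Gaussian measure on `E` with respect to the volume. -/
noncomputable def stdGaussianPDF (x : E) : ℝ≥0∞ :=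
  ENNReal.ofReal ((2 * Real.pi) ^ (-(Module.finrank ℝ E / 2 : ℝ)) * Real.exp (-(‖x‖ ^ 2 / 2)))

theorem stdGaussianPDF_ne_zero (x : E) : stdGaussianPDF E x ≠ 0 := by
  simp only [stdGaussianPDF, ne_eq, ENNReal.ofReal_eq_zero, not_le]
  positivity

variable [MeasurableSpace E] [BorelSpace E]

@[fun_prop]
theorem measurable_stdGaussianPDF : Measurable (stdGaussianPDF E) := by
  unfold stdGaussianPDF; fun_prop

variable [FiniteDimensional ℝ E]

/-- Both sides are finite measures with the same characteristic function. -/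
theorem stdGaussian_eq_withDensity :
    stdGaussian E = (volume : Measure E).withDensity (stdGaussianPDF E) := by
  set k : ℝ := (2 * Real.pi) ^ (-(Module.finrank ℝ E / 2 : ℝ)) with hk
  have hint : ∫ x : E, k * Real.exp (-(‖x‖ ^ 2 / 2)) = 1 := by
    have h := GaussianFourier.integral_rexp_neg_mul_sq_norm (V := E) (b := 1 / 2) (by norm_num)
    rw [integral_const_mul]
    have h2 : (fun x : E => Real.exp (-(‖x‖ ^ 2 / 2))) =
        fun x => Real.exp (-(1 / 2) * ‖x‖ ^ 2) := by ext; congr 1; ring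
    rw [h2, h, hk, show Real.pi / (1 / 2) = 2 * Real.pi by ring,
      ← Real.rpow_add (by positivity)]
    simp
  have hfin : IsFiniteMeasure ((volume : Measure E).withDensity (stdGaussianPDF E)) := by
    refine isFiniteMeasure_withDensity_ofReal ?_
    exact (Integrable.of_integral_ne_zero (by rw [hint]; norm_num)).2
  refine Measure.ext_of_charFun ?_
  ext t
  rw [charFun_stdGaussian, charFun_apply]
  unfold stdGaussianPDF
  rw [integral_withDensity_eq_integral_toReal_smul (by fun_prop)
    (ae_of_all _ fun _ => ENNReal.ofReal_lt_top)]
  have h := GaussianFourier.integral_cexp_neg_mul_sq_norm_add (V := E) (b := 1 / 2) (by norm_num)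
    Complex.I t
  have h2 : ∀ x : E, (ENNReal.ofReal (k * Real.exp (-(‖x‖ ^ 2 / 2)))).toReal •
      Complex.exp (⟪x, t⟫ * Complex.I) =
      (k : ℂ) * Complex.exp (-(1 / 2) * ‖x‖ ^ 2 + Complex.I * ⟪t, x⟫) := by
    intro x
    rw [ENNReal.toReal_ofReal (by positivity), Complex.real_smul, real_inner_comm, Complex.exp_add]
    push_cast
    rw [show -(1 / 2 : ℂ) * ‖x‖ ^ 2 = -(‖x‖ ^ 2 / 2) by ring,
      mul_comm Complex.I]
    ring
  refine Eq.symm ((integral_congr_ae (ae_of_all _ h2)).trans ?_)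
  rw [integral_const_mul, h, ← mul_assoc]
  have h3 : (k : ℂ) * ((Real.pi : ℂ) / (1 / 2)) ^ (Module.finrank ℝ E / 2 : ℂ) = 1 := by
    rw [show (Real.pi : ℂ) / (1 / 2) = ((2 * Real.pi : ℝ) : ℂ) by push_cast; ring,
      show (Module.finrank ℝ E / 2 : ℂ) = ((Module.finrank ℝ E / 2 : ℝ) : ℂ) by push_cast; ring,
      ← Complex.ofReal_cpow (by positivity), ← Complex.ofReal_mul, hk,
      ← Real.rpow_add (by positivity)]
    simp
  rw [h3, one_mul]
  congr 1
  rw [Complex.I_sq]; ring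

theorem stdGaussian_absolutelyContinuous : stdGaussian E ≪ volume := by
  rw [stdGaussian_eq_withDensity]; exact withDensity_absolutelyContinuous _ _

theorem volume_absolutelyContinuous_stdGaussian : (volume : Measure E) ≪ stdGaussian E := by
  rw [stdGaussian_eq_withDensity]
  exact withDensity_absolutelyContinuous' (by fun_prop)
    (ae_of_all _ fun x => stdGaussianPDF_ne_zero x)

theorem ae_stdGaussian : ae (stdGaussian E) = ae (volume : Measure E) :=
  le_antisymm stdGaussian_absolutelyContinuous.ae_le volume_absolutelyContinuous_stdGaussian.ae_le

theorem map_inner_stdGaussian {u : E} (hu : ‖u‖ = 1) :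
    (stdGaussian E).map (fun x => ⟪u, x⟫) = gaussianReal 0 1 := by
  have := IsGaussian.map_eq_gaussianReal (μ := stdGaussian E) (innerSL ℝ u)
  rw [variance_dual_stdGaussian, innerSL_apply_norm, hu, integral_strongDual_stdGaussian] at this
  simpa using this

end StandardGaussian

theorem integral_exp_neg_mul_sub_sq_gaussianReal {t : ℝ} (ht : 0 ≤ t) (w : ℝ) :
    ∫ z, Real.exp (-(t * (z - w) ^ 2)) ∂gaussianReal 0 1 =
      (Real.sqrt (1 + 2 * t))⁻¹ * Real.exp (-(t * w ^ 2 / (1 + 2 * t))) := by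
  rw [integral_gaussianReal_eq_integral_smul one_ne_zero]
  have h1 : ∀ z, gaussianPDFReal 0 1 z • Real.exp (-(t * (z - w) ^ 2)) =
      ((Real.sqrt (2 * Real.pi))⁻¹ * Real.exp (-(t * w ^ 2 / (1 + 2 * t)))) *
        Real.exp (-(t + 1 / 2) * (z - 2 * t * w / (1 + 2 * t)) ^ 2) := by
    intro z
    have h2 : (1 + 2 * t) ≠ 0 := by positivity
    simp only [gaussianPDFReal_def, smul_eq_mul, NNReal.coe_one, mul_one, sub_zero]
    rw [mul_assoc, mul_assoc, ← Real.exp_add, ← Real.exp_add]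
    congr 2
    field_simp
    ring
  simp_rw [h1]
  rw [integral_const_mul,
    integral_sub_right_eq_self (fun z => Real.exp (-(t + 1 / 2) * z ^ 2)), integral_gaussian]
  have h3 : Real.pi / (t + 1 / 2) = 2 * Real.pi / (1 + 2 * t) := by
    field_simp
    ring
  rw [h3, Real.sqrt_div (by positivity)]
  have : Real.sqrt (2 * Real.pi) ≠ 0 := by positivity
  field_simp

/-! ### Densities with respect to the standard Gaussian measure -/

theorem map_withDensity_comp {α β : Type*} [MeasurableSpace α] [MeasurableSpace β]
    {μ : Measure α} {T : α → β} (hT : Measurable T) {f : β → ℝ≥0∞} (hf : Measurable f) :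
    (μ.withDensity fun x => f (T x)).map T = (μ.map T).withDensity f := by
  ext A hA
  rw [Measure.map_apply hT hA, withDensity_apply _ (hT hA), withDensity_apply _ hA,
    setLIntegral_map hA hf hT]

section MultivariateGaussian

variable {ι : Type*} [Fintype ι] [DecidableEq ι]

/-- With `M = √S`, the measure is the image of the standard one under `x ↦ m + M x`, and
`‖M⁻¹ z‖² = ⟪z, S⁻¹ z⟫`. -/
theorem multivariateGaussian_eq_withDensity (m : EuclideanSpace ℝ ι) {S : Matrix ι ι ℝ}
    (hS : S.PosDef) :
    multivariateGaussian m S = (stdGaussian (EuclideanSpace ℝ ι)).withDensity fun y =>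
      ENNReal.ofReal (Real.exp (-(Real.log S.det / 2) +
        (‖y‖ ^ 2 - ⟪y - m, Matrix.toEuclideanCLM (𝕜 := ℝ) S⁻¹ (y - m)⟫) / 2)) := by
  set M : Matrix ι ι ℝ := CFC.sqrt S with hM
  have hMM : M * M = S := CFC.sqrt_mul_sqrt_self _ hS.posSemidef.nonneg
  have hdet : M.det * M.det = S.det := by rw [← Matrix.det_mul, hMM]
  have hSdet : 0 < S.det := hS.det_pos
  have hM0 : M.det ≠ 0 := fun h => by rw [h] at hdet; simp at hdet; exact hSdet.ne hdet
  have hMu : IsUnit M.det := hM0.isUnit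
  have hMh : M.IsHermitian := (CFC.sqrt_nonneg S).isSelfAdjoint
  have hinv : M⁻¹ * M = 1 := Matrix.nonsing_inv_mul _ hMu
  set L := Matrix.toEuclideanCLM (n := ι) (𝕜 := ℝ) M with hL
  set K := Matrix.toEuclideanCLM (n := ι) (𝕜 := ℝ) M⁻¹ with hK
  have hKL : ∀ x, K (L x) = x := fun x => by
    change (K * L) x = x
    rw [hK, hL, ← map_mul, hinv, map_one]; rfl
  have hKK : ∀ z, ⟪z, Matrix.toEuclideanCLM (𝕜 := ℝ) S⁻¹ z⟫ = ‖K z‖ ^ 2 := by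
    intro z
    have hKs : IsSelfAdjoint K := by
      rw [hK]
      exact (show IsSelfAdjoint M⁻¹ from hMh.inv).map _
    rw [← hMM, Matrix.mul_inv_rev, map_mul, ← real_inner_self_eq_norm_sq]
    change ⟪z, K (K z)⟫ = _
    rw [← ContinuousLinearMap.adjoint_inner_left, hKs.adjoint_eq]
  have hLdet : LinearMap.det (L : EuclideanSpace ℝ ι →ₗ[ℝ] EuclideanSpace ℝ ι) = M.det := by
    rw [hL, Matrix.coe_toEuclideanCLM_eq_toEuclideanLin]
    exact LinearMap.det_toLpLin _ _
  have hmap : (volume : Measure (EuclideanSpace ℝ ι)).map (fun x => m + L x) =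
      ENNReal.ofReal |M.det|⁻¹ • volume := by
    have h1 : (fun x => m + L x) = (fun x => m + x) ∘ L := rfl
    rw [h1, ← Measure.map_map (measurable_const_add m) (by fun_prop)]
    have h2 := Measure.map_linearMap_addHaar_eq_smul_addHaar
      (volume : Measure (EuclideanSpace ℝ ι)) (f := L) (by rw [hLdet]; exact hM0)
    rw [hLdet] at h2
    change Measure.map L volume = _ at h2
    rw [h2, Measure.map_smul, map_add_left_eq_self, abs_inv]
  rw [multivariateGaussian]
  change Measure.map (fun x => m + L x) _ = _
  rw [stdGaussian_eq_withDensity]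
  have h3 : stdGaussianPDF (EuclideanSpace ℝ ι) =
      fun x => (fun y => stdGaussianPDF (EuclideanSpace ℝ ι) (K (y - m))) (m + L x) := by
    ext x; simp [hKL]
  conv_lhs => rw [h3]
  rw [map_withDensity_comp (T := fun x => m + L x)
    (f := fun y => stdGaussianPDF (EuclideanSpace ℝ ι) (K (y - m))) (by fun_prop) (by fun_prop),
    hmap, withDensity_smul_measure,
    ← withDensity_smul _ (by fun_prop), ← withDensity_mul _ (by fun_prop) (by fun_prop)]
  congr 1
  ext y
  simp only [Pi.smul_apply, Pi.mul_apply, smul_eq_mul, stdGaussianPDF, hKK]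
  rw [← ENNReal.ofReal_mul (by positivity), ← ENNReal.ofReal_mul (by positivity)]
  congr 1
  have h4 : Real.exp (-(Real.log S.det / 2)) = |M.det|⁻¹ := by
    rw [← hdet, ← abs_mul_abs_self, Real.log_mul (abs_ne_zero.2 hM0) (abs_ne_zero.2 hM0),
      ← Real.exp_log (abs_pos.2 hM0), ← Real.exp_neg]
    simp
  rw [← h4, mul_left_comm, mul_assoc, ← Real.exp_add, ← Real.exp_add]
  congr 2
  ring

variable {n : ℕ}

theorem rankOnePerturbation_det (ε : ℝ) {u : EuclideanSpace ℝ (Fin n)} (hu : ‖u‖ = 1) :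
    (rankOnePerturbation ε u).det = 1 + ε := by
  rw [rankOnePerturbation, ← Matrix.smul_vecMulVec, Matrix.vecMulVec_eq Unit,
    Matrix.det_one_add_replicateCol_mul_replicateRow, dotProduct_smul]
  have : u.ofLp ⬝ᵥ u.ofLp = 1 := by
    have := EuclideanSpace.real_norm_sq_eq u
    rw [hu] at this
    simp only [dotProduct, ← pow_two]; linarith
  simp [this]

theorem toEuclideanCLM_rankOnePerturbation (ε : ℝ) (u x : EuclideanSpace ℝ (Fin n)) :
    Matrix.toEuclideanCLM (𝕜 := ℝ) (rankOnePerturbation ε u) x = x + (ε * ⟪u, x⟫) • u := by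
  ext i
  simp only [rankOnePerturbation, map_add, map_one, map_smul, _root_.add_apply,
    _root_.smul_apply, PiLp.add_apply, PiLp.smul_apply,
    Matrix.ofLp_toEuclideanCLM, Matrix.vecMulVec_mulVec, PiLp.inner_apply]
  simp [dotProduct, mul_comm, mul_left_comm]

theorem rankOnePerturbation_posDef {ε : ℝ} (hε : -1 < ε) {u : EuclideanSpace ℝ (Fin n)}
    (hu : ‖u‖ = 1) : (rankOnePerturbation ε u).PosDef := by
  refine Matrix.PosDef.of_dotProduct_mulVec_pos ?_ ?_
  · rw [rankOnePerturbation, Matrix.IsHermitian, Matrix.conjTranspose_add]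
    congr 1
    · simp
    · ext i j
      simp [Matrix.vecMulVec_apply, mul_comm]
  · intro x hx
    have h := Matrix.inner_toEuclideanCLM (rankOnePerturbation ε u) (WithLp.toLp 2 x)
      (WithLp.toLp 2 x)
    rw [toEuclideanCLM_rankOnePerturbation, inner_add_right, real_inner_self_eq_norm_sq,
      inner_smul_right, real_inner_comm u] at h
    have hCS := abs_real_inner_le_norm u (WithLp.toLp 2 x)
    rw [hu, one_mul] at hCS
    have hpos : 0 < ‖WithLp.toLp 2 x‖ := by simpa using hx
    have hsq := sq_le_sq' (neg_le_of_abs_le hCS) (le_of_abs_le hCS)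
    have : 0 < x ⬝ᵥ (rankOnePerturbation ε u).mulVec x := by
      change _ = x ⬝ᵥ (rankOnePerturbation ε u).mulVec x at h
      rw [← h]
      rcases le_or_gt 0 ε with h0 | h0
      · nlinarith [mul_nonneg h0 (sq_nonneg ⟪u, WithLp.toLp 2 x⟫), pow_pos hpos 2]
      · nlinarith [mul_pos (show 0 < 1 + ε by linarith) (pow_pos hpos 2)]
    simpa using this

theorem rankOnePerturbation_inv {ε : ℝ} (hε : -1 < ε) {u : EuclideanSpace ℝ (Fin n)}
    (hu : ‖u‖ = 1) :
    (rankOnePerturbation ε u)⁻¹ = rankOnePerturbation (-(ε / (1 + ε))) u := by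
  have h1 : 1 + ε ≠ 0 := by linarith
  refine Matrix.inv_eq_left_inv
    (EquivLike.injective (Matrix.toEuclideanCLM (n := Fin n) (𝕜 := ℝ)) ?_)
  rw [map_mul, map_one]
  ext1 x
  rw [mul_apply_eq_comp, one_apply_eq_self]
  rw [toEuclideanCLM_rankOnePerturbation, toEuclideanCLM_rankOnePerturbation, inner_add_right, inner_smul_right,
    real_inner_self_eq_norm_sq, hu, add_assoc, ← add_smul]
  have : ε * ⟪u, x⟫ + -(ε / (1 + ε)) * (⟪u, x⟫ + ε * ⟪u, x⟫ * 1 ^ 2) = 0 := by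
    field_simp; ring
  rw [this]; simp

theorem multivariateGaussian_rankOnePerturbation_eq_withDensity {ε : ℝ} (hε : -1 < ε)
    {u : EuclideanSpace ℝ (Fin n)} (hu : ‖u‖ = 1) :
    multivariateGaussian 0 (rankOnePerturbation ε u) =
      (stdGaussian (EuclideanSpace ℝ (Fin n))).withDensity fun y =>
        ENNReal.ofReal (Real.exp (-(Real.log (1 + ε) / 2) +
          ε / (2 * (1 + ε)) * ⟪u, y⟫ ^ 2)) := by
  rw [multivariateGaussian_eq_withDensity 0 (rankOnePerturbation_posDef hε hu),
    rankOnePerturbation_inv hε hu, rankOnePerturbation_det ε hu]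
  congr 1
  ext y
  rw [sub_zero, toEuclideanCLM_rankOnePerturbation, inner_add_right, inner_smul_right,
    real_inner_self_eq_norm_sq, real_inner_comm]
  have h1 : 1 + ε ≠ 0 := by linarith
  congr 4
  field_simp
  ring

end MultivariateGaussian

/-! ### Quadratic functions distributed as the square of a standard normal variable -/

section QuadraticLaw

theorem integral_exp_neg_sum_stdGaussian {ι E : Type*} [Fintype ι] [NormedAddCommGroup E]
    [InnerProductSpace ℝ E] [FiniteDimensional ℝ E] [MeasurableSpace E] [BorelSpace E]
    (b : OrthonormalBasis ι ℝ E) {l : ι → ℝ} (hl : ∀ i, 0 ≤ l i) (w : ι → ℝ) :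
    ∫ y, Real.exp (-∑ i, l i * (⟪b i, y⟫ - w i) ^ 2) ∂stdGaussian E =
      ∏ i, (Real.sqrt (1 + 2 * l i))⁻¹ * Real.exp (-(l i * w i ^ 2 / (1 + 2 * l i))) := by
  rw [stdGaussian_eq_map_pi_orthonormalBasis b,
    integral_map (Measurable.aemeasurable (by fun_prop)) (Measurable.aestronglyMeasurable (by fun_prop))]
  have h1 : ∀ x : ι → ℝ, Real.exp (-∑ i, l i * (⟪b i, ∑ j, x j • b j⟫ - w i) ^ 2) =
      ∏ i, Real.exp (-(l i * (x i - w i) ^ 2)) := by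
    intro x
    rw [← Real.exp_sum, Finset.sum_neg_distrib]
    simp_rw [b.orthonormal.inner_right_fintype]
  simp_rw [h1]
  rw [integral_fintype_prod_eq_prod (f := fun i z => Real.exp (-(l i * (z - w i) ^ 2)))]
  exact Finset.prod_congr rfl fun i _ => integral_exp_neg_mul_sub_sq_gaussianReal (hl i) (w i)

/-- A multiple `l (Z - w)²` of a noncentral chi-squared variable with one degree of freedom has the
Laplace transform of `Z²` only if it is `Z²`. -/
theorem eq_zero_and_eq_one_of_noncentral {l w : ℝ} (hl : 0 < l)
    (h : ∀ t, 0 < t → (1 + t * l) * Real.exp (t * l * w ^ 2 / (1 + t * l)) = 1 + t) :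
    w = 0 ∧ l = 1 := by
  -- in the variable `s = 1 / (1 + t l)` the identity says that `exp (w² (1 - s))` is affine
  have key : ∀ s, 0 < s → s < 1 → Real.exp (w ^ 2 * (1 - s)) = s + (1 - s) / l := by
    intro s hs0 hs1
    have hs := h ((1 - s) / (s * l)) (div_pos (by linarith) (by positivity))
    have h1 : 1 + (1 - s) / (s * l) * l = 1 / s := by field_simp; ring
    have h2 : (1 - s) / (s * l) * l * w ^ 2 / (1 / s) = w ^ 2 * (1 - s) := by field_simp
    rw [h1, h2] at hs
    field_simp at hs ⊢
    linarith
  -- the values at `s = 3/4, 1/2, 1/4` are `r`, `r²`, `r³`; in arithmetic progression they force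
  -- `r = 1`
  set r := Real.exp (w ^ 2 / 4) with hr
  have e1 : Real.exp (w ^ 2 * (1 - 3 / 4)) = r := by rw [hr]; congr 1; ring
  have e2 : Real.exp (w ^ 2 * (1 - 1 / 2)) = r ^ 2 := by
    rw [hr, ← Real.exp_nat_mul]; congr 1; push_cast; ring
  have e3 : Real.exp (w ^ 2 * (1 - 1 / 4)) = r ^ 3 := by
    rw [hr, ← Real.exp_nat_mul]; congr 1; push_cast; ring
  have k1 := key (3 / 4) (by norm_num) (by norm_num)
  have k2 := key (1 / 2) (by norm_num) (by norm_num)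
  have k3 := key (1 / 4) (by norm_num) (by norm_num)
  rw [e1] at k1; rw [e2] at k2; rw [e3] at k3
  have hr0 : 0 < r := Real.exp_pos _
  have hr1 : r * (r - 1) ^ 2 = 0 := by
    have : r + r ^ 3 = 2 * r ^ 2 := by linear_combination k1 + k3 - 2 * k2
    linarith [this]
  have hr2 : r = 1 := by
    rcases mul_eq_zero.1 hr1 with h0 | h0
    · exact absurd h0 hr0.ne'
    · exact sub_eq_zero.1 (pow_eq_zero_iff two_ne_zero |>.1 h0)
  have hw : w = 0 := by
    have : w ^ 2 / 4 = 0 := Real.exp_eq_one_iff _ |>.1 hr2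
    exact pow_eq_zero_iff two_ne_zero |>.1 (by linarith)
  refine ⟨hw, ?_⟩
  rw [hr2] at k2
  have : 1 / l = 1 := by
    have : (1 - 1 / 2) / l = 1 / l / 2 := by ring
    linarith
  rwa [one_div, inv_eq_one] at this

/-- The hypothesis `h` is the reciprocal square of the equality between the Laplace transforms of
`d / 2 + ∑ i, l i (Z i - w i)² / 2`, with independent standard normal `Z i`, and of `Z² / 2`. -/
theorem exists_unique_weight_of_laplace {ι : Type*} [Fintype ι] [DecidableEq ι] {l w : ι → ℝ}
    {d : ℝ}
    (hl : ∀ i, 0 ≤ l i) (hd : 0 ≤ d)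
    (h : ∀ t, 0 < t → Real.exp (t * d) * ∏ i, (1 + t * l i) *
      Real.exp (t * l i * w i ^ 2 / (1 + t * l i)) = 1 + t) :
    d = 0 ∧ ∃ i, l i = 1 ∧ w i = 0 ∧ ∀ j, j ≠ i → l j = 0 := by
  have hfac : ∀ t, 0 < t → ∀ i, 1 + t * l i ≤ (1 + t * l i) *
      Real.exp (t * l i * w i ^ 2 / (1 + t * l i)) := by
    intro t ht i
    have : 0 ≤ t * l i := mul_nonneg ht.le (hl i)
    refine le_mul_of_one_le_right (by positivity) (Real.one_le_exp (by positivity))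
  have hfac1 : ∀ t, 0 < t → ∀ i, 1 ≤ (1 + t * l i) *
      Real.exp (t * l i * w i ^ 2 / (1 + t * l i)) := fun t ht i =>
    (by linarith [mul_nonneg ht.le (hl i)] : 1 ≤ 1 + t * l i).trans (hfac t ht i)
  -- a product of two nonconstant affine factors outgrows `1 + t`
  have hgrow : ∀ a b : ℝ, 0 < a → 0 < b → ¬ ∀ t, 0 < t → (1 + t * a) * (1 + t * b) ≤ 1 + t := by
    intro a b ha hb hab
    have := hab (1 / (a * b)) (by positivity)
    have e : (1 + 1 / (a * b) * a) * (1 + 1 / (a * b) * b) =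
      1 + 1 / a + 1 / b + 1 / (a * b) := by field_simp; ring
    rw [e] at this
    have : 0 < 1 / a := by positivity
    have : 0 < 1 / b := by positivity
    linarith
  by_cases hex : ∃ i, 0 < l i
  · obtain ⟨i, hi⟩ := hex
    have hsplit : ∀ t, (∏ j, (1 + t * l j) * Real.exp (t * l j * w j ^ 2 / (1 + t * l j))) =
        ((1 + t * l i) * Real.exp (t * l i * w i ^ 2 / (1 + t * l i))) *
        ∏ j ∈ Finset.univ.erase i,
          (1 + t * l j) * Real.exp (t * l j * w j ^ 2 / (1 + t * l j)) := fun t =>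
      (Finset.mul_prod_erase _ _ (Finset.mem_univ i)).symm
    have hd0 : d = 0 := by
      by_contra hne
      refine hgrow d (l i) (lt_of_le_of_ne hd (Ne.symm hne)) hi fun t ht => ?_
      rw [← h t ht, hsplit]
      have h1 : 1 + t * d ≤ Real.exp (t * d) := by linarith [Real.add_one_le_exp (t * d)]
      have h2 : 1 ≤ ∏ j ∈ Finset.univ.erase i,
          (1 + t * l j) * Real.exp (t * l j * w j ^ 2 / (1 + t * l j)) :=
        Finset.prod_induction _ (1 ≤ ·) (fun _ _ => one_le_mul_of_one_le_of_one_le) le_rfl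
          fun j _ => hfac1 t ht j
      have h3 := hfac t ht i
      have h4 : 0 ≤ t * l i := by positivity
      refine mul_le_mul h1 (h3.trans (le_mul_of_one_le_right (by linarith) h2)) (by linarith)
        (Real.exp_pos _).le
    have hothers : ∀ j, j ≠ i → l j = 0 := by
      intro j hj
      by_contra hne
      refine hgrow (l i) (l j) hi (lt_of_le_of_ne (hl j) (Ne.symm hne)) fun t ht => ?_
      rw [← h t ht, hsplit, hd0, mul_zero, Real.exp_zero, one_mul,
        ← Finset.mul_prod_erase _ _ (Finset.mem_erase.2 ⟨hj, Finset.mem_univ j⟩)]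
      have h2 : 1 ≤ ∏ k ∈ (Finset.univ.erase i).erase j,
          (1 + t * l k) * Real.exp (t * l k * w k ^ 2 / (1 + t * l k)) :=
        Finset.prod_induction _ (1 ≤ ·) (fun _ _ => one_le_mul_of_one_le_of_one_le) le_rfl
          fun k _ => hfac1 t ht k
      have h3 := hfac t ht i
      have h4 := hfac t ht j
      have h5 : 0 ≤ t * l i := by positivity
      have h6 : 0 ≤ t * l j := mul_nonneg ht.le (hl j)
      exact mul_le_mul h3 (h4.trans (le_mul_of_one_le_right (by linarith) h2)) (by linarith)
        (by linarith)
    have hone := eq_zero_and_eq_one_of_noncentral (l := l i) (w := w i) hi fun t ht => by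
      rw [← h t ht, hsplit, hd0, mul_zero, Real.exp_zero, one_mul,
        Finset.prod_eq_one (s := Finset.univ.erase i), mul_one]
      intro j hj
      rw [hothers j (Finset.ne_of_mem_erase hj)]
      simp
    exact ⟨hd0, i, hone.2, hone.1, hothers⟩
  · -- otherwise `exp (t d) = 1 + t` for all `t > 0`, which fails at `t = 1` or `t = 2`
    have hz : ∀ i, l i = 0 := fun i => le_antisymm (not_lt.1 fun hi => hex ⟨i, hi⟩) (hl i)
    have hexp : ∀ t, 0 < t → Real.exp (t * d) = 1 + t := fun t ht => by
      simpa [hz] using h t ht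
    have h1 := hexp 1 one_pos
    have h2 := hexp 2 two_pos
    rw [two_mul, Real.exp_add] at h2
    rw [one_mul] at h1
    rw [h1] at h2
    norm_num at h2

variable {E : Type*} [NormedAddCommGroup E] [InnerProductSpace ℝ E] [FiniteDimensional ℝ E]
  [MeasurableSpace E] [BorelSpace E]

/-- A nonnegative quadratic function whose Laplace transform under the standard Gaussian measure is
that of the square of a standard normal variable is the square of a unit linear form. -/
theorem exists_eq_inner_sq_of_integral_exp {Q : E →ₗ[ℝ] E} (hQ : Q.IsSymmetric) (b : E) (d : ℝ)
    (hnonneg : ∀ y, 0 ≤ ⟪y, Q y⟫ + ⟪b, y⟫ + d)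
    (hint : ∀ t, 0 < t → ∫ y, Real.exp (-(t * (⟪y, Q y⟫ + ⟪b, y⟫ + d))) ∂stdGaussian E =
      (Real.sqrt (1 + 2 * t))⁻¹) :
    ∃ v : E, ‖v‖ = 1 ∧ ∀ y, ⟪y, Q y⟫ + ⟪b, y⟫ + d = ⟪v, y⟫ ^ 2 := by
  set e := hQ.eigenvectorBasis rfl with he
  set l := hQ.eigenvalues rfl with hl
  have hQe : ∀ i, Q (e i) = l i • e i := fun i => hQ.apply_eigenvectorBasis rfl i
  have hform : ∀ y, ⟪y, Q y⟫ + ⟪b, y⟫ + d =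
      (∑ i, (l i * ⟪e i, y⟫ ^ 2 + ⟪b, e i⟫ * ⟪e i, y⟫)) + d := by
    intro y
    rw [← e.sum_inner_mul_inner y (Q y), ← e.sum_inner_mul_inner b y, ← Finset.sum_add_distrib]
    congr 2
    ext i
    rw [← hQ, hQe, real_inner_smul_left, real_inner_comm (e i) y]
    ring
  have hline : ∀ i (s : ℝ), 0 ≤ l i * s ^ 2 + ⟪b, e i⟫ * s + d := by
    intro i s
    have := hnonneg (s • e i)
    rw [map_smul, hQe, real_inner_smul_left, real_inner_smul_right, real_inner_smul_right,
      real_inner_smul_right, real_inner_self_eq_norm_sq, e.norm_eq_one] at this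
    linarith
  have hl0 : ∀ i, 0 ≤ l i := by
    intro i
    by_contra! hneg
    -- for large `s` the quadratic term dominates
    set B := |⟪b, e i⟫|
    have hB : 0 ≤ B := abs_nonneg _
    have hd : 0 ≤ d := by simpa using hline i 0
    have h1 := hline i ((B + d + 1) / (-l i) + 1)
    set s := (B + d + 1) / (-l i) + 1 with hs
    have hs1 : 1 ≤ s := by
      have : 0 ≤ (B + d + 1) / (-l i) := div_nonneg (by linarith) (by linarith)
      linarith
    have hs2 : (-l i) * s = B + d + 1 + (-l i) := by
      rw [hs, mul_add, mul_div_cancel₀ _ (by linarith)]; ring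
    have h3 : ⟪b, e i⟫ * s ≤ B * s := mul_le_mul_of_nonneg_right (le_abs_self _) (by linarith)
    have h4 : l i * s ^ 2 = -((B + d + 1 + (-l i)) * s) := by rw [← hs2]; ring
    nlinarith
  have hb0 : ∀ i, l i = 0 → ⟪b, e i⟫ = 0 := by
    intro i hi
    by_contra hne
    -- a linear function takes negative values
    have h1 := hline i (-(d + 1) / ⟪b, e i⟫)
    rw [hi, mul_div_cancel₀ _ hne] at h1
    linarith
  -- complete the squares; where `l i = 0` the centre `w i` is the junk value `0`
  set w : Fin (Module.finrank ℝ E) → ℝ := fun i => -⟪b, e i⟫ / (2 * l i) with hw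
  set d' := d - ∑ i, l i * w i ^ 2 with hd'
  have hsq : ∀ y, ⟪y, Q y⟫ + ⟪b, y⟫ + d = (∑ i, l i * (⟪e i, y⟫ - w i) ^ 2) + d' := by
    intro y
    rw [hform, hd', add_sub, add_sub_right_comm, ← Finset.sum_sub_distrib]
    congr 2
    ext i
    by_cases hi : l i = 0
    · simp [hi, hb0 i hi]
    · simp only [hw]
      field_simp
      ring
  have hd0 : 0 ≤ d' := by
    have := hnonneg (∑ i, w i • e i)
    rw [hsq] at this
    simpa [e.orthonormal.inner_right_fintype] using this
  have hlaplace : ∀ t, 0 < t → Real.exp (t * d') * ∏ i, (1 + t * l i) *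
      Real.exp (t * l i * w i ^ 2 / (1 + t * l i)) = 1 + t := by
    intro t ht
    have h1 := hint (t / 2) (by positivity)
    simp_rw [hsq] at h1
    have h2 : ∀ y : E, Real.exp (-(t / 2 * ((∑ i, l i * (⟪e i, y⟫ - w i) ^ 2) + d'))) =
        Real.exp (-(t / 2 * d')) *
          Real.exp (-∑ i, (t / 2 * l i) * (⟪e i, y⟫ - w i) ^ 2) := by
      intro y
      rw [← Real.exp_add]
      congr 1
      simp_rw [mul_assoc, ← Finset.mul_sum]
      ring
    simp_rw [h2] at h1
    rw [integral_const_mul, integral_exp_neg_sum_stdGaussian e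
      (fun i => mul_nonneg (by positivity) (hl0 i))] at h1
    have h3 := congrArg (fun z => (z ^ 2)⁻¹) h1
    simp only [mul_pow, ← Finset.prod_pow, inv_pow, ← Finset.prod_inv_distrib, mul_inv, inv_inv]
      at h3
    rw [Real.sq_sqrt (by positivity), show 1 + 2 * (t / 2) = 1 + t by ring] at h3
    rw [← h3]
    congr 1
    · rw [← Real.exp_nat_mul, ← Real.exp_neg]; congr 1; push_cast; ring
    · refine Finset.prod_congr rfl fun i _ => ?_
      have h4 : 0 ≤ t * l i := mul_nonneg ht.le (hl0 i)
      rw [Real.sq_sqrt (by linarith), ← Real.exp_nat_mul, ← Real.exp_neg]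
      have h5 : 1 + 2 * (t / 2 * l i) = 1 + t * l i := by ring
      rw [h5]
      congr 2
      push_cast
      ring
  obtain ⟨hd1, i, hi1, hi2, hi3⟩ := exists_unique_weight_of_laplace hl0 hd0 hlaplace
  refine ⟨e i, e.norm_eq_one i, fun y => ?_⟩
  rw [hsq, hd1, add_zero, Finset.sum_eq_single i, hi1, hi2, one_mul, sub_zero]
  · intro j _ hj
    rw [hi3 j hj, zero_mul]
  · simp

end QuadraticLaw

/-! ### Images of rank one perturbations of the standard Gaussian measure -/

section Transport

variable {n : ℕ} {T : EuclideanSpace ℝ (Fin n) → EuclideanSpace ℝ (Fin n)}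
  {u v : EuclideanSpace ℝ (Fin n)} {ε : ℝ}

theorem map_multivariateGaussian_rankOnePerturbation (hTm : Measurable T)
    (hT : (stdGaussian (EuclideanSpace ℝ (Fin n))).map T = stdGaussian _)
    (hε : -1 < ε) (hu : ‖u‖ = 1) (hv : ‖v‖ = 1) (h : ∀ᵐ x, ⟪v, T x⟫ ^ 2 = ⟪u, x⟫ ^ 2) :
    (multivariateGaussian 0 (rankOnePerturbation ε u)).map T =
      multivariateGaussian 0 (rankOnePerturbation ε v) := by
  rw [multivariateGaussian_rankOnePerturbation_eq_withDensity hε hu,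
    multivariateGaussian_rankOnePerturbation_eq_withDensity hε hv]
  conv_rhs => rw [← hT]
  rw [← map_withDensity_comp hTm (by fun_prop)]
  congr 1
  refine withDensity_congr_ae ?_
  rw [Filter.EventuallyEq, ae_stdGaussian]
  filter_upwards [h] with x hx
  rw [hx]

/-- As `T` preserves the standard Gaussian measure, it carries the density of the Gaussian measure
with covariance `I + ε u u'` to the density of its image. The logarithms of both are quadratic, so
`⟪u, x⟫²` is a quadratic function of `T x`. -/
theorem exists_inner_sq_eq_of_isNonsingularGaussian_map
    {T : EuclideanSpace ℝ (Fin n) ≃ᵐ EuclideanSpace ℝ (Fin n)}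
    (hT : (stdGaussian (EuclideanSpace ℝ (Fin n))).map T = stdGaussian _)
    (hε : -1 < ε) (hε0 : ε ≠ 0) (hu : ‖u‖ = 1)
    (hG : IsNonsingularGaussian ((multivariateGaussian 0 (rankOnePerturbation ε u)).map T)) :
    ∃ v : EuclideanSpace ℝ (Fin n), ‖v‖ = 1 ∧ ∀ᵐ x, ⟪v, T x⟫ ^ 2 = ⟪u, x⟫ ^ 2 := by
  obtain ⟨m, S, hS, hmap⟩ := hG
  set P := Matrix.toEuclideanCLM (n := Fin n) (𝕜 := ℝ) S⁻¹ with hP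
  have hPsymm : (P : EuclideanSpace ℝ (Fin n) →ₗ[ℝ] EuclideanSpace ℝ (Fin n)).IsSymmetric :=
    ContinuousLinearMap.isSelfAdjoint_iff_isSymmetric.1
      ((show IsSelfAdjoint S⁻¹ from hS.isHermitian.inv).map _)
  set k := -(Real.log S.det / 2)
  set c := -(Real.log (1 + ε) / 2)
  set a := ε / (2 * (1 + ε)) with ha
  have ha0 : a ≠ 0 := div_ne_zero hε0 (by linarith)
  rw [multivariateGaussian_rankOnePerturbation_eq_withDensity hε hu,
    multivariateGaussian_eq_withDensity m hS] at hmap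
  set f : EuclideanSpace ℝ (Fin n) → ℝ≥0∞ :=
    fun y => ENNReal.ofReal (Real.exp (c + a * ⟪u, y⟫ ^ 2)) with hf
  have hfm : Measurable f := by fun_prop
  have hfTm : Measurable fun y => f (T.symm y) := hfm.comp T.symm.measurable
  have hfT : f = fun x => (fun y => f (T.symm y)) (T x) := by ext x; simp
  rw [hfT, map_withDensity_comp (f := fun y => f (T.symm y)) T.measurable hfTm, hT] at hmap
  rw [withDensity_eq_iff_of_sigmaFinite hfTm.aemeasurable (by fun_prop)]
    at hmap
  have hlog : ∀ᵐ x ∂stdGaussian (EuclideanSpace ℝ (Fin n)),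
      c + a * ⟪u, x⟫ ^ 2 = k + (‖T x‖ ^ 2 - ⟪T x - m, P (T x - m)⟫) / 2 := by
    rw [← hT] at hmap
    filter_upwards [ae_of_ae_map T.measurable.aemeasurable hmap] with x hx
    simp only [T.symm_apply_apply, hf] at hx
    rw [ENNReal.ofReal_eq_ofReal_iff (Real.exp_pos _).le (Real.exp_pos _).le] at hx
    exact Real.exp_injective hx
  -- the quadratic function `(log g - c) / a`, with `g` the density of the image, is
  -- `⟪y, Q y⟫ + ⟪b, y⟫ + d`
  set Q : EuclideanSpace ℝ (Fin n) →ₗ[ℝ] EuclideanSpace ℝ (Fin n) :=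
    (1 / (2 * a)) • (LinearMap.id - (P : EuclideanSpace ℝ (Fin n) →ₗ[ℝ] EuclideanSpace ℝ (Fin n))) with hQ
  set b := (1 / a) • P m with hb
  set d := (k - ⟪m, P m⟫ / 2 - c) / a with hd
  have hp : ∀ y, ⟪y, Q y⟫ + ⟪b, y⟫ + d =
      (k + (‖y‖ ^ 2 - ⟪y - m, P (y - m)⟫) / 2 - c) / a := by
    intro y
    have h1 : ⟪m, P y⟫ = ⟪P m, y⟫ := (hPsymm m y).symm
    have h2 : ⟪y, P m⟫ = ⟪P m, y⟫ := real_inner_comm _ _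
    simp only [hQ, hb, hd, LinearMap.smul_apply, LinearMap.sub_apply, LinearMap.id_apply,
      ContinuousLinearMap.coe_coe, inner_smul_right, real_inner_smul_left, inner_sub_right,
      inner_sub_left, map_sub, real_inner_self_eq_norm_sq, h1, h2]
    field_simp
    ring
  have hpT : ∀ᵐ x ∂stdGaussian (EuclideanSpace ℝ (Fin n)),
      ⟪T x, Q (T x)⟫ + ⟪b, T x⟫ + d = ⟪u, x⟫ ^ 2 := by
    filter_upwards [hlog] with x hx
    rw [hp, ← hx]
    field_simp
    ring
  have hQsymm : Q.IsSymmetric := by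
    intro x y
    have h1 := hPsymm x y
    simp only [ContinuousLinearMap.coe_coe] at h1
    simp only [hQ, LinearMap.smul_apply, LinearMap.sub_apply, LinearMap.id_apply,
      ContinuousLinearMap.coe_coe, inner_smul_right, real_inner_smul_left, inner_sub_right,
      inner_sub_left, h1]
  have hQc : Continuous fun y => ⟪y, Q y⟫ + ⟪b, y⟫ + d := by
    have := Q.continuous_of_finiteDimensional
    fun_prop
  have hnonneg : ∀ y, 0 ≤ ⟪y, Q y⟫ + ⟪b, y⟫ + d := by
    have hae : ∀ᵐ y ∂stdGaussian (EuclideanSpace ℝ (Fin n)), 0 ≤ ⟪y, Q y⟫ + ⟪b, y⟫ + d := by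
      rw [← hT, ae_map_iff T.measurable.aemeasurable
        (measurableSet_le measurable_const hQc.measurable)]
      filter_upwards [hpT] with x hx
      rw [hx]; positivity
    rw [ae_stdGaussian, ae_iff] at hae
    have hopen : IsOpen {y | ¬ 0 ≤ ⟪y, Q y⟫ + ⟪b, y⟫ + d} := by
      simp only [not_le]
      exact isOpen_lt hQc continuous_const
    intro y
    by_contra hy
    exact (Set.eq_empty_iff_forall_notMem.1 ((hopen.measure_eq_zero_iff volume).1 hae) y) hy
  have hint : ∀ t, 0 < t → ∫ y, Real.exp (-(t * (⟪y, Q y⟫ + ⟪b, y⟫ + d)))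
      ∂stdGaussian (EuclideanSpace ℝ (Fin n)) = (Real.sqrt (1 + 2 * t))⁻¹ := by
    intro t ht
    conv_lhs => rw [← hT]
    rw [integral_map T.measurable.aemeasurable
      (Measurable.aestronglyMeasurable (by have := hQc.measurable; fun_prop))]
    have h1 : ∫ x, Real.exp (-(t * (⟪T x, Q (T x)⟫ + ⟪b, T x⟫ + d)))
        ∂stdGaussian (EuclideanSpace ℝ (Fin n)) =
        ∫ x, Real.exp (-(t * (⟪u, x⟫ - 0) ^ 2)) ∂stdGaussian (EuclideanSpace ℝ (Fin n)) := by
      refine integral_congr_ae ?_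
      filter_upwards [hpT] with x hx
      rw [hx, sub_zero]
    rw [h1, ← integral_map (φ := fun x => ⟪u, x⟫) (f := fun z => Real.exp (-(t * (z - 0) ^ 2)))
      (Measurable.aemeasurable (by fun_prop)) (Measurable.aestronglyMeasurable (by fun_prop)),
      map_inner_stdGaussian hu, integral_exp_neg_mul_sub_sq_gaussianReal ht.le]
    simp
  obtain ⟨v, hv, hvy⟩ := exists_eq_inner_sq_of_integral_exp hQsymm b d hnonneg hint
  refine ⟨v, hv, ?_⟩
  rw [← ae_stdGaussian]
  filter_upwards [hpT] with x hx
  rw [← hvy, hx]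

end Transport

/-! ### Piecewise linear maps that preserve the standard Gaussian measure -/

section Jacobian

variable {E : Type*} [NormedAddCommGroup E] [InnerProductSpace ℝ E] [FiniteDimensional ℝ E]
  [MeasurableSpace E] [BorelSpace E]

/-- By the change of variables formula, the Gaussian density `φ` satisfies `φ x = |det W| φ (W x)`
almost everywhere on `F`, so `‖W x‖² - ‖x‖²` is constant there. -/
theorem norm_map_eq_of_map_stdGaussian_eq {T : E ≃ᵐ E}
    (hT : (stdGaussian E).map T = stdGaussian E) {F : Set E} (hF : MeasurableSet F)
    (hF0 : volume F ≠ 0) (W : E →ₗ[ℝ] E) (hW : ∀ x ∈ F, T x = W x) (x : E) : ‖W x‖ = ‖x‖ := by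
  set L : E →L[ℝ] E := LinearMap.toContinuousLinearMap W with hL
  have hLW : ∀ x, L x = W x := fun x => rfl
  have hdens : (volume.restrict F).withDensity (stdGaussianPDF E) =
      (volume.restrict F).withDensity
        fun x => ENNReal.ofReal |L.det| * stdGaussianPDF E (L x) := by
    ext s hs
    rw [withDensity_apply _ hs, withDensity_apply _ hs, Measure.restrict_restrict hs]
    have hsF : MeasurableSet (s ∩ F) := hs.inter hF
    have hTL : T '' (s ∩ F) = L '' (s ∩ F) :=
      Set.image_congr fun x hx => hW x hx.2
    have hinj : Set.InjOn L (s ∩ F) := by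
      intro x hx y hy hxy
      rw [hLW, hLW, ← hW x hx.2, ← hW y hy.2] at hxy
      exact T.injective hxy
    have hTm : MeasurableSet (T '' (s ∩ F)) := T.measurableSet_image.2 hsF
    rw [← lintegral_image_eq_lintegral_abs_det_fderiv_mul volume hsF
      (fun x _ => L.hasFDerivAt.hasFDerivWithinAt) hinj, ← hTL,
      ← withDensity_apply _ hTm, ← withDensity_apply _ hsF, ← stdGaussian_eq_withDensity]
    conv_rhs => rw [← hT]
    rw [Measure.map_apply T.measurable hTm, Set.preimage_image_eq _ T.injective]
  rw [withDensity_eq_iff_of_sigmaFinite (by fun_prop) (by fun_prop)] at hdens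
  refine norm_map_eq_of_volume_ne_zero W (2 * Real.log |L.det|) (fun h0 => hF0 ?_) x
  have hae : ∀ᵐ x ∂volume.restrict F, ‖W x‖ ^ 2 - ‖x‖ ^ 2 = 2 * Real.log |L.det| := by
    filter_upwards [hdens] with x hx
    rw [stdGaussianPDF, stdGaussianPDF, ← ENNReal.ofReal_mul (abs_nonneg _),
      ENNReal.ofReal_eq_ofReal_iff (by positivity) (by positivity), mul_left_comm] at hx
    have hx2 := mul_left_cancel₀ (by positivity) hx
    have hdet : |L.det| ≠ 0 := fun h => by
      rw [h, zero_mul] at hx2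
      exact (Real.exp_pos _).ne' hx2
    have hx3 := congrArg Real.log hx2
    rw [Real.log_mul hdet (Real.exp_pos _).ne', Real.log_exp, Real.log_exp, hLW] at hx3
    linarith
  rw [ae_restrict_iff' hF, ae_iff] at hae
  refine measure_mono_null (fun x hx => ?_) (measure_union_null h0 hae)
  by_cases hxc : ‖W x‖ ^ 2 - ‖x‖ ^ 2 = 2 * Real.log |L.det|
  · exact Or.inl hxc
  · exact Or.inr fun h => hxc (h hx)

end Jacobian

/-! ### Orthogonal matrices and sign matrices -/

section SignMatrices

variable {n : ℕ}

theorem mem_orthogonalGroup_iff_norm {W : Matrix (Fin n) (Fin n) ℝ} :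
    W ∈ Matrix.orthogonalGroup (Fin n) ℝ ↔ ∀ x, ‖Matrix.toEuclideanLin W x‖ = ‖x‖ := by
  rw [Matrix.mem_orthogonalGroup_iff']
  have h := ContinuousLinearMap.norm_map_iff_adjoint_comp_self
    (Matrix.toEuclideanCLM (n := Fin n) (𝕜 := ℝ) W)
  refine Iff.trans ?_ h.symm
  rw [← ContinuousLinearMap.star_eq_adjoint, ← ContinuousLinearMap.mul_def, ← map_star, ← map_mul,
    EmbeddingLike.map_eq_one_iff, Matrix.star_eq_conjTranspose,
    Matrix.conjTranspose_eq_transpose_of_trivial]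

theorem signMatrix_transpose (s : Fin n → ℤˣ) : (signMatrix s).transpose = signMatrix s :=
  Matrix.diagonal_transpose _

theorem signMatrix_mul_self (s : Fin n → ℤˣ) : signMatrix s * signMatrix s = 1 := by
  rw [signMatrix, Matrix.diagonal_mul_diagonal, ← Matrix.diagonal_one]
  congr 1
  ext i
  rcases Int.units_eq_one_or (s i) with h | h <;> simp [h]

theorem signMatrix_mem_orthogonalGroup (s : Fin n → ℤˣ) :
    signMatrix s ∈ Matrix.orthogonalGroup (Fin n) ℝ := by
  rw [Matrix.mem_orthogonalGroup_iff, signMatrix_transpose, signMatrix_mul_self]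

theorem signMatrix_mulVec (s : Fin n → ℤˣ) (x : Fin n → ℝ) (i : Fin n) :
    (signMatrix s).mulVec x i = ((s i : ℤ) : ℝ) * x i := by
  rw [signMatrix, Matrix.mulVec_diagonal]

theorem exists_linearIsometryEquiv_signMap {U V : Matrix (Fin n) (Fin n) ℝ}
    (hU : U ∈ Matrix.orthogonalGroup (Fin n) ℝ) (hV : V ∈ Matrix.orthogonalGroup (Fin n) ℝ)
    (s : Fin n → ℤˣ) :
    ∃ e : EuclideanSpace ℝ (Fin n) ≃ₗᵢ[ℝ] EuclideanSpace ℝ (Fin n), ⇑e = signMap U V s := by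
  have h := mem_orthogonalGroup_iff_norm.1
    (mul_mem (mul_mem hV (signMatrix_mem_orthogonalGroup s)) hU)
  exact ⟨LinearIsometry.toLinearIsometryEquiv ⟨signMap U V s, h⟩ rfl, rfl⟩

theorem volume_signMap_eq_signMap {U V : Matrix (Fin n) (Fin n) ℝ}
    (hU : U ∈ Matrix.orthogonalGroup (Fin n) ℝ) (hV : V ∈ Matrix.orthogonalGroup (Fin n) ℝ)
    {s t : Fin n → ℤˣ} (hst : s ≠ t) :
    volume {x | signMap U V s x = signMap U V t x} = 0 := by
  have hset : {x | signMap U V s x = signMap U V t x} =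
      ((signMap U V s - signMap U V t).ker : Set (EuclideanSpace ℝ (Fin n))) := by
    ext x; simp [sub_eq_zero]
  rw [hset]
  refine Measure.addHaar_submodule _ _ fun htop => hst ?_
  rw [LinearMap.ker_eq_top, sub_eq_zero] at htop
  have h1 : V * signMatrix s * U = V * signMatrix t * U := Matrix.toEuclideanLin.injective htop
  have hUu := (Unitary.toUnits ⟨U, hU⟩).isUnit
  have hVu := (Unitary.toUnits ⟨V, hV⟩).isUnit
  have h2 : signMatrix s = signMatrix t := hVu.mul_left_cancel (hUu.mul_right_cancel h1)
  ext i
  have h3 := congrFun (Matrix.diagonal_injective h2) i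
  exact_mod_cast h3

/-- The factors are `U = (A A')^(-1/2) A` and `V = B⁻¹ (B B')^(1/2)`, which do not depend on `s`.
If `B⁻¹ s A` is orthogonal, then `B B' = s A A' s`, whence `(B B')^(1/2) = s (A A')^(1/2) s`. -/
theorem exists_orthogonal_factors {A B : Matrix (Fin n) (Fin n) ℝ} (hA : IsUnit A)
    (hB : IsUnit B) :
    ∃ U ∈ Matrix.orthogonalGroup (Fin n) ℝ, ∃ V ∈ Matrix.orthogonalGroup (Fin n) ℝ,
      ∀ s, B⁻¹ * signMatrix s * A ∈ Matrix.orthogonalGroup (Fin n) ℝ →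
        V * signMatrix s * U = B⁻¹ * signMatrix s * A := by
  have hpos : ∀ M : Matrix (Fin n) (Fin n) ℝ, IsUnit M →
      (CFC.sqrt (M * M.transpose)).transpose = CFC.sqrt (M * M.transpose) ∧
        CFC.sqrt (M * M.transpose) * CFC.sqrt (M * M.transpose) = M * M.transpose ∧
        IsUnit (CFC.sqrt (M * M.transpose)).det := by
    intro M hM
    have h0 : 0 ≤ M * M.transpose := by
      rw [← Matrix.conjTranspose_eq_transpose_of_trivial]
      exact (Matrix.posSemidef_self_mul_conjTranspose M).nonneg
    have h1 : CFC.sqrt (M * M.transpose) * CFC.sqrt (M * M.transpose) = M * M.transpose :=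
      CFC.sqrt_mul_sqrt_self _ h0
    refine ⟨?_, h1, ?_⟩
    · rw [← Matrix.conjTranspose_eq_transpose_of_trivial]
      exact (CFC.sqrt_nonneg (M * M.transpose)).isSelfAdjoint
    · have h2 := congrArg Matrix.det h1
      rw [Matrix.det_mul, Matrix.det_mul, Matrix.det_transpose] at h2
      have h3 : M.det ≠ 0 := ((Matrix.isUnit_iff_isUnit_det M).1 hM).ne_zero
      exact IsUnit.mk0 _ fun h => by
        rw [h, zero_mul] at h2
        exact mul_ne_zero h3 h3 h2.symm
  obtain ⟨hGt, hGG, hGu⟩ := hpos A hA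
  obtain ⟨hHt, hHH, -⟩ := hpos B hB
  set R := CFC.sqrt (A * A.transpose) with hR
  set R' := CFC.sqrt (B * B.transpose) with hR'
  have hBd : IsUnit B.det := (Matrix.isUnit_iff_isUnit_det B).1 hB
  refine ⟨R⁻¹ * A, ?_, B⁻¹ * R', ?_, fun s hs => ?_⟩
  · rw [Matrix.mem_orthogonalGroup_iff, Matrix.transpose_mul,
      Matrix.transpose_nonsing_inv, hGt]
    calc R⁻¹ * A * (A.transpose * R⁻¹) = R⁻¹ * (A * A.transpose) * R⁻¹ := by
          simp only [Matrix.mul_assoc]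
      _ = 1 := by
          rw [← hGG, ← Matrix.mul_assoc, Matrix.nonsing_inv_mul _ hGu, Matrix.one_mul,
            Matrix.mul_nonsing_inv _ hGu]
  · rw [Matrix.mem_orthogonalGroup_iff, Matrix.transpose_mul,
      Matrix.transpose_nonsing_inv, hHt]
    calc B⁻¹ * R' * (R' * B.transpose⁻¹) = B⁻¹ * (R' * R') * B.transpose⁻¹ := by
          simp only [Matrix.mul_assoc]
      _ = 1 := by
          rw [hHH, ← Matrix.mul_assoc, Matrix.nonsing_inv_mul _ hBd, Matrix.one_mul,
            Matrix.mul_nonsing_inv _ (by rwa [Matrix.det_transpose])]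
  · set D := signMatrix s with hD
    have hDD : D * D = 1 := signMatrix_mul_self s
    have hDt : D.transpose = D := signMatrix_transpose s
    have hgram : D * (A * A.transpose) * D = B * B.transpose := by
      rw [Matrix.mem_orthogonalGroup_iff, Matrix.transpose_mul, Matrix.transpose_mul,
        Matrix.transpose_nonsing_inv, hDt] at hs
      have h1 := congrArg (fun M => B * M * B.transpose) hs
      simp only [Matrix.mul_one] at h1
      rw [← h1]
      simp only [← Matrix.mul_assoc]
      rw [Matrix.mul_nonsing_inv _ hBd, Matrix.one_mul, Matrix.mul_assoc _ B.transpose⁻¹,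
        Matrix.nonsing_inv_mul _ (by rwa [Matrix.det_transpose]), Matrix.mul_one]
    -- conjugation by `D` maps the positive square root of one Gram matrix to that of the other
    have hsqrt : R' = D * R * D := by
      refine CFC.sqrt_unique ?_ ?_
      · calc D * R * D * (D * R * D) = D * R * (D * D) * R * D := by
              simp only [Matrix.mul_assoc]
          _ = D * (R * R) * D := by rw [hDD]; simp only [Matrix.mul_one, Matrix.mul_assoc]
          _ = _ := by rw [hGG, hgram]
      · have h1 := (Matrix.nonneg_iff_posSemidef.1 (CFC.sqrt_nonneg
          (A * A.transpose))).mul_mul_conjTranspose_same D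
        rw [Matrix.conjTranspose_eq_transpose_of_trivial, hDt] at h1
        exact h1.nonneg
    calc B⁻¹ * R' * D * (R⁻¹ * A) = B⁻¹ * D * R * (D * D) * R⁻¹ * A := by
          rw [hsqrt]; simp only [Matrix.mul_assoc]
      _ = B⁻¹ * D * (R * R⁻¹) * A := by rw [hDD]; simp only [Matrix.mul_one, Matrix.mul_assoc]
      _ = B⁻¹ * D * A := by rw [Matrix.mul_nonsing_inv _ hGu, Matrix.mul_one]

end SignMatrices

/-! ### Sign representations -/

section SignRepresentation

/-- A countable family that covers almost every point still does so after its null members are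
discarded. -/
theorem ae_exists_mem_of_ae_exists {α κ : Type*} [MeasurableSpace α] {μ : Measure α} [Countable κ]
    {F : κ → Set α} (h : ∀ᵐ x ∂μ, ∃ s, x ∈ F s) : ∀ᵐ x ∂μ, ∃ s, μ (F s) ≠ 0 ∧ x ∈ F s := by
  have h0 : ∀ᵐ x ∂μ, ∀ s, μ (F s) = 0 → x ∉ F s :=
    ae_all_iff.2 fun s => by
      by_cases hs : μ (F s) = 0
      · filter_upwards [measure_eq_zero_iff_ae_notMem.1 hs] with x hx _ using hx
      · exact ae_of_all _ fun x h => absurd h hs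
  filter_upwards [h, h0] with x ⟨s, hs⟩ hx
  exact ⟨s, fun h => hx s h hs, hs⟩

variable {n : ℕ}

/-- The set of the points `x` at which `⟪v j, T x⟫ = s j * ⟪u j, x⟫` for every `j`. In terms of the
matrices `A`, `B` with rows `u j`, `v j`, this says `B (T x) = s A x`. -/
def signSet (T : EuclideanSpace ℝ (Fin n) → EuclideanSpace ℝ (Fin n))
    (u v : Fin n → EuclideanSpace ℝ (Fin n)) (s : Fin n → ℤˣ) : Set (EuclideanSpace ℝ (Fin n)) :=
  {x | ∀ j, ⟪v j, T x⟫ = ((s j : ℤ) : ℝ) * ⟪u j, x⟫}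

theorem measurableSet_signSet {T : EuclideanSpace ℝ (Fin n) → EuclideanSpace ℝ (Fin n)}
    (hT : Measurable T) (u v : Fin n → EuclideanSpace ℝ (Fin n)) (s : Fin n → ℤˣ) :
    MeasurableSet (signSet T u v s) := by
  simp only [signSet, Set.ofPred_forall]
  exact MeasurableSet.iInter fun j => measurableSet_eq_fun (by fun_prop) (by fun_prop)

theorem ae_exists_mem_signSet {T : EuclideanSpace ℝ (Fin n) → EuclideanSpace ℝ (Fin n)}
    {u v : Fin n → EuclideanSpace ℝ (Fin n)}
    (h : ∀ j, ∀ᵐ x, ⟪v j, T x⟫ ^ 2 = ⟪u j, x⟫ ^ 2) :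
    ∀ᵐ x, ∃ s, volume (signSet T u v s) ≠ 0 ∧ x ∈ signSet T u v s := by
  refine ae_exists_mem_of_ae_exists ?_
  filter_upwards [ae_all_iff.2 h] with x hx
  have : ∀ j, ∃ σ : ℤˣ, ⟪v j, T x⟫ = ((σ : ℤ) : ℝ) * ⟪u j, x⟫ := by
    intro j
    rcases sq_eq_sq_iff_eq_or_eq_neg.1 (hx j) with h1 | h1
    · exact ⟨1, by simpa using h1⟩
    · exact ⟨-1, by simpa using h1⟩
  choose s hs using this
  exact ⟨s, hs⟩

/-- A linear relation between the `v j` gives, on a sign set of positive measure, a linear form in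
`x` that vanishes there; its coefficients are those of the relation up to sign. -/
theorem linearIndependent_of_inner_sq_eq
    {T : EuclideanSpace ℝ (Fin n) → EuclideanSpace ℝ (Fin n)}
    {u v : Fin n → EuclideanSpace ℝ (Fin n)} (hu : LinearIndependent ℝ u)
    (h : ∀ j, ∀ᵐ x, ⟪v j, T x⟫ ^ 2 = ⟪u j, x⟫ ^ 2) : LinearIndependent ℝ v := by
  obtain ⟨-, s, hs, -⟩ := (ae_exists_mem_signSet h).exists
  rw [Fintype.linearIndependent_iff] at hu ⊢
  intro g hg i
  have h1 : ∑ j, (g j * ((s j : ℤ) : ℝ)) • u j = 0 := by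
    refine eq_zero_of_volume_inner_eq_zero fun h0 => hs (measure_mono_null (fun x hx => ?_) h0)
    have h2 : ⟪∑ j, g j • v j, T x⟫ = 0 := by rw [hg, inner_zero_left]
    rw [sum_inner] at h2
    change ⟪∑ j, (g j * ((s j : ℤ) : ℝ)) • u j, x⟫ = 0
    rw [sum_inner, ← h2]
    refine Finset.sum_congr rfl fun j _ => ?_
    rw [real_inner_smul_left, real_inner_smul_left, hx j, mul_assoc]
  have h3 := hu _ h1 i
  rcases Int.units_eq_one_or (s i) with h4 | h4 <;> simpa [h4] using h3

theorem IsSignRepresentation.ae_exists {T : EuclideanSpace ℝ (Fin n) → EuclideanSpace ℝ (Fin n)}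
    {U V : Matrix (Fin n) (Fin n) ℝ} {E : (Fin n → ℤˣ) → Set (EuclideanSpace ℝ (Fin n))}
    (h : IsSignRepresentation T U V E) :
    ∀ᵐ x, ∃ s, volume (E s) ≠ 0 ∧ x ∈ E s := by
  refine ae_exists_mem_of_ae_exists ?_
  have := h.partition.cover
  rw [← Set.compl_eq_univ_sdiff, measure_eq_zero_iff_ae_notMem] at this
  filter_upwards [this] with x hx
  simpa using hx

theorem IsSignRepresentation.ae_eq_signMap
    {T : EuclideanSpace ℝ (Fin n) → EuclideanSpace ℝ (Fin n)}
    {U V : Matrix (Fin n) (Fin n) ℝ} {E : (Fin n → ℤˣ) → Set (EuclideanSpace ℝ (Fin n))}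
    (h : IsSignRepresentation T U V E) :
    ∀ᵐ x, ∀ s, x ∈ E s → T x = signMap U V s x := by
  have hdisj : ∀ᵐ x, ∀ s t, s ≠ t → ¬ (x ∈ E s ∧ x ∈ E t) := by
    refine ae_all_iff.2 fun s => ae_all_iff.2 fun t => ?_
    by_cases hst : s = t
    · exact ae_of_all _ fun x h => absurd hst h
    · filter_upwards [measure_eq_zero_iff_ae_notMem.1 (h.partition.inter s t hst)] with x hx _
        using hx
  filter_upwards [h.ae_eq, hdisj] with x hx hd s hs
  rw [hx, Finset.sum_eq_single s, Set.indicator_of_mem hs]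
  · intro t _ hts
    exact Set.indicator_of_notMem (fun ht => hd t s hts ⟨ht, hs⟩) _
  · simp

theorem IsLebesguePartition.sum_restrict {E : (Fin n → ℤˣ) → Set (EuclideanSpace ℝ (Fin n))}
    (h : IsLebesguePartition E) {μ : Measure (EuclideanSpace ℝ (Fin n))} (hμ : μ ≪ volume) :
    μ = Measure.sum fun s => μ.restrict (E s) := by
  rw [← Measure.restrict_iUnion_ae (fun s t hst => hμ (h.inter s t hst))
    fun s => (h.measurableSet s).nullMeasurableSet]
  refine (Measure.restrict_eq_self_of_ae_mem ?_).symm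
  rw [ae_iff]
  have := hμ h.cover
  rwa [← Set.compl_eq_univ_sdiff] at this

/-- The standard Gaussian measure is invariant under each of the orthogonal maps `V s U`, so `T`
carries its restriction to `E s` to its restriction to `V s U (E s)`. -/
theorem IsSignRepresentation.map_stdGaussian
    {T : EuclideanSpace ℝ (Fin n) → EuclideanSpace ℝ (Fin n)} (hT : Measurable T)
    {U V : Matrix (Fin n) (Fin n) ℝ} {E : (Fin n → ℤˣ) → Set (EuclideanSpace ℝ (Fin n))}
    (h : IsSignRepresentation T U V E) :
    (stdGaussian (EuclideanSpace ℝ (Fin n))).map T = stdGaussian _ := by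
  conv_lhs => rw [h.partition.sum_restrict stdGaussian_absolutelyContinuous]
  conv_rhs => rw [h.image_partition.sum_restrict stdGaussian_absolutelyContinuous]
  rw [Measure.map_sum hT.aemeasurable]
  congr 1
  ext1 s
  obtain ⟨e, he⟩ := exists_linearIsometryEquiv_signMap h.orthogonal_left h.orthogonal_right s
  have hae : T =ᵐ[(stdGaussian (EuclideanSpace ℝ (Fin n))).restrict (E s)] e := by
    rw [Filter.EventuallyEq, ae_restrict_iff' (h.partition.measurableSet s), ae_stdGaussian]
    filter_upwards [h.ae_eq_signMap] with x hx hxs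
    rw [he, hx s hxs]
  have himg : E s = e ⁻¹' (signMap U V s '' E s) := by
    rw [← he, Set.preimage_image_eq _ e.injective]
  rw [Measure.map_congr hae]
  conv_lhs => rw [himg]
  rw [← Measure.restrict_map e.continuous.measurable (h.image_partition.measurableSet s),
    stdGaussian_map]

theorem IsSignRepresentation.signMap_eq_or_eq_neg
    {T : EuclideanSpace ℝ (Fin n) → EuclideanSpace ℝ (Fin n)}
    {U V : Matrix (Fin n) (Fin n) ℝ} {E : (Fin n → ℤˣ) → Set (EuclideanSpace ℝ (Fin n))}
    (h : IsSignRepresentation T U V E) {u v : EuclideanSpace ℝ (Fin n)}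
    (huv : ∀ᵐ x, ⟪v, T x⟫ ^ 2 = ⟪u, x⟫ ^ 2) {s : Fin n → ℤˣ} (hs : volume (E s) ≠ 0) :
    signMap U V s u = v ∨ signMap U V s u = -v := by
  obtain ⟨e, he⟩ := exists_linearIsometryEquiv_signMap h.orthogonal_left h.orthogonal_right s
  have hvol : volume {x | ⟪u, x⟫ ^ 2 = ⟪e.symm v, x⟫ ^ 2} ≠ 0 := by
    intro h0
    have hae := huv.and h.ae_eq_signMap
    rw [ae_iff] at hae
    refine hs (measure_mono_null (fun x hx => ?_) (measure_union_null h0 hae))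
    by_cases hx2 : ⟪v, T x⟫ ^ 2 = ⟪u, x⟫ ^ 2 ∧ ∀ s, x ∈ E s → T x = signMap U V s x
    · refine Or.inl ?_
      have h3 : ⟪e.symm v, x⟫ = ⟪v, T x⟫ := by
        rw [hx2.2 s hx, ← he, ← e.inner_map_map, e.apply_symm_apply]
      change ⟪u, x⟫ ^ 2 = ⟪e.symm v, x⟫ ^ 2
      rw [h3, hx2.1]
    · exact Or.inr hx2
  rw [← he]
  rcases eq_or_eq_neg_of_volume_inner_sq_eq hvol with h1 | h1
  · exact Or.inl (by rw [h1, e.apply_symm_apply])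
  · exact Or.inr (by rw [h1, map_neg, e.apply_symm_apply])

theorem IsSignRepresentation.ae_inner_sq_eq
    {T : EuclideanSpace ℝ (Fin n) → EuclideanSpace ℝ (Fin n)}
    {U V : Matrix (Fin n) (Fin n) ℝ} {E : (Fin n → ℤˣ) → Set (EuclideanSpace ℝ (Fin n))}
    (h : IsSignRepresentation T U V E) {u v : EuclideanSpace ℝ (Fin n)}
    (huv : ∀ s, 0 < volume (E s) → signMap U V s u = v ∨ signMap U V s u = -v) :
    ∀ᵐ x, ⟪v, T x⟫ ^ 2 = ⟪u, x⟫ ^ 2 := by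
  filter_upwards [h.ae_exists, h.ae_eq_signMap] with x ⟨s, hs, hxs⟩ hx
  obtain ⟨e, he⟩ := exists_linearIsometryEquiv_signMap h.orthogonal_left h.orthogonal_right s
  have h1 := huv s (pos_iff_ne_zero.2 hs)
  rw [hx s hxs, ← he, ← e.inner_map_map u x]
  rw [← he] at h1
  rcases h1 with h1 | h1 <;> simp [h1]

/-- The pieces are the sets `{x | T x = V s U x}`, where `U` and `V` are the orthogonal factors of
the matrices with rows `u j` and `v j`. Up to null sets they agree with the sign sets of positive
measure, on which `T` is linear and hence orthogonal. -/
theorem exists_isSignRepresentation {T : EuclideanSpace ℝ (Fin n) ≃ᵐ EuclideanSpace ℝ (Fin n)}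
    (hT : (stdGaussian (EuclideanSpace ℝ (Fin n))).map T = stdGaussian _)
    {u v : Fin n → EuclideanSpace ℝ (Fin n)} (hu : LinearIndependent ℝ u)
    (h : ∀ j, ∀ᵐ x, ⟪v j, T x⟫ ^ 2 = ⟪u j, x⟫ ^ 2) :
    ∃ U V E, IsSignRepresentation T U V E := by
  have hv := linearIndependent_of_inner_sq_eq hu h
  set A : Matrix (Fin n) (Fin n) ℝ := Matrix.of fun j => (u j).ofLp with hA
  set B : Matrix (Fin n) (Fin n) ℝ := Matrix.of fun j => (v j).ofLp with hB
  have hunit : ∀ w : Fin n → EuclideanSpace ℝ (Fin n), LinearIndependent ℝ w →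
      IsUnit (Matrix.of fun j => (w j).ofLp : Matrix (Fin n) (Fin n) ℝ) := by
    intro w hw
    rw [← Matrix.linearIndependent_rows_iff_isUnit]
    exact hw.map' (WithLp.linearEquiv 2 ℝ (Fin n → ℝ)).toLinearMap (LinearEquiv.ker _)
  have hAu : IsUnit A := hunit u hu
  have hBu : IsUnit B := hunit v hv
  have hBd : IsUnit B.det := (Matrix.isUnit_iff_isUnit_det B).1 hBu
  have hrow : ∀ (w : Fin n → EuclideanSpace ℝ (Fin n)) (x : EuclideanSpace ℝ (Fin n)) j,
      (Matrix.of fun j => (w j).ofLp : Matrix (Fin n) (Fin n) ℝ).mulVec x.ofLp j = ⟪w j, x⟫ := by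
    intro w x j
    simp [Matrix.mulVec, dotProduct, PiLp.inner_apply, mul_comm]
  have hlin : ∀ s, ∀ x ∈ signSet T u v s,
      T x = Matrix.toEuclideanLin (B⁻¹ * signMatrix s * A) x := by
    intro s x hx
    have h1 : B.mulVec (T x).ofLp = (signMatrix s).mulVec (A.mulVec x.ofLp) := by
      ext j
      rw [signMatrix_mulVec, hA, hB, hrow, hrow, hx j]
    have h2 := congrArg (B⁻¹).mulVec h1
    rw [Matrix.mulVec_mulVec, Matrix.nonsing_inv_mul _ hBd, Matrix.one_mulVec,
      Matrix.mulVec_mulVec, Matrix.mulVec_mulVec] at h2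
    ext i
    rw [h2]
    rfl
  obtain ⟨U, hU, V, hV, hUV⟩ := exists_orthogonal_factors hAu hBu
  have horth : ∀ s, volume (signSet T u v s) ≠ 0 →
      V * signMatrix s * U = B⁻¹ * signMatrix s * A := fun s hs =>
    hUV s <| mem_orthogonalGroup_iff_norm.2 <|
      norm_map_eq_of_map_stdGaussian_eq hT (measurableSet_signSet T.measurable u v s) hs _
        (hlin s)
  set E : (Fin n → ℤˣ) → Set (EuclideanSpace ℝ (Fin n)) :=
    fun s => {x | T x = signMap U V s x} with hE
  have hsm : ∀ s, Measurable (signMap U V s) := fun s =>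
    (signMap U V s).continuous_of_finiteDimensional.measurable
  have hEm : ∀ s, MeasurableSet (E s) := fun s => measurableSet_eq_fun T.measurable (hsm s)
  have hcov : ∀ᵐ x, ∃ s, x ∈ E s := by
    filter_upwards [ae_exists_mem_signSet h] with x ⟨s, hs, hx⟩
    refine ⟨s, ?_⟩
    change T x = signMap U V s x
    rw [signMap, horth s hs, hlin s x hx]
  have hinter : ∀ s t, s ≠ t → volume (E s ∩ E t) = 0 := fun s t hst =>
    measure_mono_null (fun x hx => hx.1.symm.trans hx.2) (volume_signMap_eq_signMap hU hV hst)
  have hcov0 : volume (Set.univ \ ⋃ s, E s) = 0 := by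
    rw [← Set.compl_eq_univ_sdiff, measure_eq_zero_iff_ae_notMem]
    filter_upwards [hcov] with x hx
    simpa using hx
  have himg : ∀ s, signMap U V s '' E s = T '' E s := fun s =>
    Set.image_congr fun x hx => hx.out.symm
  -- `T` maps null sets to null sets, because it preserves a measure equivalent to `volume`
  have hnull : ∀ N, MeasurableSet N → volume N = 0 → volume (T '' N) = 0 := by
    intro N hN hN0
    refine volume_absolutelyContinuous_stdGaussian ?_
    rw [← hT, Measure.map_apply T.measurable (T.measurableSet_image.2 hN),
      Set.preimage_image_eq _ T.injective]
    exact stdGaussian_absolutelyContinuous hN0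
  refine ⟨U, V, E, hU, hV, ⟨hEm, hcov0, hinter⟩, ?_, ⟨fun s => ?_, ?_, fun s t hst => ?_⟩⟩
  · have hdisj : ∀ᵐ x, ∀ s t, s ≠ t → ¬ (x ∈ E s ∧ x ∈ E t) := by
      refine ae_all_iff.2 fun s => ae_all_iff.2 fun t => ?_
      by_cases hst : s = t
      · exact ae_of_all _ fun x h => absurd hst h
      · filter_upwards [measure_eq_zero_iff_ae_notMem.1 (hinter s t hst)] with x hx _ using hx
    filter_upwards [hcov, hdisj] with x ⟨s, hs⟩ hd
    rw [Finset.sum_eq_single s, Set.indicator_of_mem hs]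
    · exact hs
    · intro t _ hts
      exact Set.indicator_of_notMem (fun ht => hd t s hts ⟨ht, hs⟩) _
    · simp
  · rw [himg]
    exact T.measurableSet_image.2 (hEm s)
  · simp only [himg]
    rw [← Set.image_iUnion, ← Set.image_univ_of_surjective T.surjective,
      ← Set.image_sdiff T.injective]
    exact hnull _ (MeasurableSet.univ.diff (MeasurableSet.iUnion hEm)) hcov0
  · rw [himg, himg, ← Set.image_inter T.injective]
    exact hnull _ ((hEm s).inter (hEm t)) (hinter s t hst)

end SignRepresentation

/-! ### Preservation of normality -/

theorem theorem4p4 {n : ℕ}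
    (T : EuclideanSpace ℝ (Fin n) ≃ᵐ EuclideanSpace ℝ (Fin n))
    (ε : Fin n → ℝ) (hε : ∀ j, -1 < ε j) (hε0 : ∀ j, ε j ≠ 0)
    (u : Module.Basis (Fin n) ℝ (EuclideanSpace ℝ (Fin n))) (hu : ∀ j, ‖u j‖ = 1) :
    (PreservesNormality T ε u ↔
      ∃ (U V : Matrix (Fin n) (Fin n) ℝ) (E : (Fin n → ℤˣ) → Set (EuclideanSpace ℝ (Fin n))),
        IsSignRepresentation T U V E ∧
        ∃ v : Module.Basis (Fin n) ℝ (EuclideanSpace ℝ (Fin n)), (∀ j, ‖v j‖ = 1) ∧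
          ∀ s, 0 < volume (E s) → ∀ j, signMap U V s (u j) = v j ∨ signMap U V s (u j) = -v j) ∧
    (PreservesNormality T ε u →
      ∀ (U V : Matrix (Fin n) (Fin n) ℝ) (E : (Fin n → ℤˣ) → Set (EuclideanSpace ℝ (Fin n))),
        IsSignRepresentation T U V E →
        ∃ v : Module.Basis (Fin n) ℝ (EuclideanSpace ℝ (Fin n)), (∀ j, ‖v j‖ = 1) ∧
          (∀ s, 0 < volume (E s) → ∀ j, signMap U V s (u j) = v j ∨ signMap U V s (u j) = -v j) ∧
          ∀ j, (multivariateGaussian 0 (rankOnePerturbation (ε j) (u j))).map T =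
            multivariateGaussian 0 (rankOnePerturbation (ε j) (v j))) := by
  have hbasis : PreservesNormality T ε u →
      (stdGaussian (EuclideanSpace ℝ (Fin n))).map T = stdGaussian _ ∧
      ∃ v : Module.Basis (Fin n) ℝ (EuclideanSpace ℝ (Fin n)), (∀ j, ‖v j‖ = 1) ∧
        ∀ j, ∀ᵐ x, ⟪v j, T x⟫ ^ 2 = ⟪u j, x⟫ ^ 2 := by
    intro h
    have hT : (stdGaussian (EuclideanSpace ℝ (Fin n))).map T = stdGaussian _ := by
      simpa using h.1
    choose v hv hvT using fun j =>
      exists_inner_sq_eq_of_isNonsingularGaussian_map hT (hε j) (hε0 j) (hu j) (h.2 j)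
    have hli := linearIndependent_of_inner_sq_eq u.linearIndependent hvT
    refine ⟨hT, Module.Basis.mk hli
      (hli.span_eq_top_of_card_eq_finrank' (by simp)).ge, ?_, ?_⟩
    · simpa using hv
    · simpa using hvT
  refine ⟨⟨fun h => ?_, ?_⟩, fun h U V E hE => ?_⟩
  · obtain ⟨hT, v, hv, hvT⟩ := hbasis h
    obtain ⟨U, V, E, hE⟩ := exists_isSignRepresentation hT u.linearIndependent hvT
    exact ⟨U, V, E, hE, v, hv, fun s hs j => hE.signMap_eq_or_eq_neg (hvT j) hs.ne'⟩
  · rintro ⟨U, V, E, hE, v, hv, hvE⟩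
    have hT := hE.map_stdGaussian T.measurable
    refine ⟨by simpa using hT, fun j => ⟨0, rankOnePerturbation (ε j) (v j),
      rankOnePerturbation_posDef (hε j) (hv j), ?_⟩⟩
    exact map_multivariateGaussian_rankOnePerturbation T.measurable hT (hε j) (hu j) (hv j)
      (hE.ae_inner_sq_eq fun s hs => hvE s hs j)
  · obtain ⟨hT, v, hv, hvT⟩ := hbasis h
    exact ⟨v, hv, fun s hs j => hE.signMap_eq_or_eq_neg (hvT j) hs.ne', fun j =>
      map_multivariateGaussian_rankOnePerturbation T.measurable hT (hε j) (hu j) (hv j) (hvT j)⟩
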